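/- Let $n\ge 1$, $s\in(0,1)$, and let $\Omega\subset\mathbb R^n$ be open and bounded. Let $G(t)=\int_0^t g(\tau)\,d\tau$ be a Young function, i.e. $g$ is right continuous on $[0,\infty)$, $g(0)=0$, $g(t)>0$ for $t>0$, $g$ is nondecreasing on $(0,\infty)$ and $g(t)\to\infty$ as $t\to\infty$; assume that for some constants $p^\pm$ $$1<p^-\le \frac{t g(t)}{G(t)}\le p^+<\infty\qquad\text{for all } t>0 .$$ Let $\beta\in L^\infty(\mathbb R^n\setminus\Omega)$ with $\beta>0$ a.e. Write $D_su(x,y)=\frac{u(x)-u(y)}{|x-y|^s}$, $d\nu=\frac{dx\,dy}{|x-y|^n}$, $\Omega_*=\mathbb R^{2n}\setminus(\Omega^c)^2$, and $$\Phi_{G,\Omega}(u)=\int_\Omega G(|u|)\,dx,\qquad \mathcal E_S(u,v)=\iint_S g(|D_su|)\frac{D_su}{|D_su|}D_sv\,d\nu ,\qquad b_u(v)=\int_\Omega g(|u|)\frac{u}{|u|}v\,dx$$ (the integrands are read as $0$ where $D_su=0$, respectively $u=0$). Consider the spaces of (classes of) measurable functions * $W^{s,G}_0(\Omega)$: $u$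 on $\mathbb R^n$ with $\int_{\mathbb R^n}G(|u|)\,dx<\infty$, $\iint_{\mathbb R^{2n}}G(|D_su|)\,d\nu<\infty$ and $u=0$ a.e. in $\mathbb R^n\setminus\Omega$; * $W^{s,G}_*(\Omega)$: $u$ on $\mathbb R^n$ with $\Phi_{G,\Omega}(u)<\infty$ and $\iint_{\Omega_*}G(|D_su|)\,d\nu<\infty$; * $W^{s,G}_{reg}(\Omega)$: $u$ on $\Omega$ with $\Phi_{G,\Omega}(u)<\infty$ and $\iint_{\Omega\times\Omega}G(|D_su|)\,d\nu<\infty$; * $\mathcal X$: $u$ on $\mathbb R^n$ with $\iint_{\Omega_*}G(|D_su|)\,d\nu+\Phi_{G,\Omega}(u)+\int_{\mathbb R^n\setminus\Omega}\beta G(|u|)\,dx<\infty$. A real number $\lambda$ is called an eigenvalue with eigenfunction $u$ of * the Dirichlet problem if $u\in W^{s,G}_0(\Omega)$ and $\mathcal E_{\mathbb R^{2n}}(u,v)=(\lambda-1)\,b_u(v)$ for all $v\in W^{s,G}_0(\Omega)$; * the Neumann problem if $u\in W^{s,G}_*(\Omega)$ and $\frac12\mathcal E_{\Omega_*}(u,v)=(\lambda-1)\,b_u(v)$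 for all $v\in W^{s,G}_*(\Omega)$; * the regional Neumann problem if $u\in W^{s,G}_{reg}(\Omega)$ and $\mathcal E_{\Omega\times\Omega}(u,v)=(\lambda-1)\,b_u(v)$ for all $v\in W^{s,G}_{reg}(\Omega)$; * the Robin problem if $u\in\mathcal X$ and $\frac12\mathcal E_{\Omega_*}(u,v)=(\lambda-1)\,b_u(v)-\int_{\mathbb R^n\setminus\Omega}\beta g(|u|)\frac{u}{|u|}v\,dx$ for all $v\in\mathcal X$. **Theorem.** There is a constant $c>0$, independent of $\mu$ (it may depend on $n,s,g,p^\pm,\Omega,\beta$), such that for every $\mu>0$ the following holds: whenever $\lambda_D$, $\lambda_R$, $\lambda_N$, $\lambda_{\tilde N}$ are eigenvalues of the Dirichlet, Robin, Neumann and regional Neumann problem, respectively, with eigenfunctions $u_D,u_R,u_N,u_{\tilde N}$ normalized by $\Phi_{G,\Omega}(u_D)=\Phi_{G,\Omega}(u_R)=\Phi_{G,\Omega}(u_N)=\Phi_{G,\Omega}(u_{\tilde N})=\mu$, then $\lambda_D\ge c$, $\lambda_R\ge c$, $\lambda_N\ge c$ and $\lambda_{\tilde N}\ge c$. -/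

import Mathlib

open MeasureTheory Set Filter Topology

noncomputable section

namespace FracOrlicz

/-- `g` is the density of a Young function: right continuous on `[0,∞)`, `g 0 = 0`, positive and
nondecreasing on `(0,∞)`, tending to `∞` at `∞`. Values of `g` at negative arguments are never
used. -/
structure IsYoungDensity (g : ℝ → ℝ) : Prop where
  rightCont : ∀ t : ℝ, 0 ≤ t → ContinuousWithinAt g (Ici t) t
  zero : g 0 = 0
  pos : ∀ t : ℝ, 0 < t → 0 < g t
  mono : MonotoneOn g (Ioi 0)
  atTop : Tendsto g atTop atTop

/-- The Young function `G t = ∫_0^t g`. -/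
def youngFun (g : ℝ → ℝ) (t : ℝ) : ℝ := ∫ τ in (0 : ℝ)..t, g τ

/-- `1 < p⁻ ≤ t g(t) / G(t) ≤ p⁺ < ∞` for all `t > 0`. -/
def GrowthCondition (g : ℝ → ℝ) (pm pp : ℝ) : Prop :=
  1 < pm ∧ ∀ t : ℝ, 0 < t → pm ≤ t * g t / youngFun g t ∧ t * g t / youngFun g t ≤ pp

/-- The odd extension `t ↦ g(|t|) t / |t|` (equal to `0` at `t = 0`). -/
def oddExt (g : ℝ → ℝ) (t : ℝ) : ℝ := g |t| * (t / |t|)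

variable {n : ℕ}

/-- The measure `dx dy / |x - y|^n` on `ℝⁿ × ℝⁿ`. -/
def singMeasure (n : ℕ) : Measure (EuclideanSpace ℝ (Fin n) × EuclideanSpace ℝ (Fin n)) :=
  (volume.prod volume).withDensity fun z => ENNReal.ofReal (1 / ‖z.1 - z.2‖ ^ n)

/-- The `s`-Hölder quotient `(u(x) - u(y)) / |x - y|^s`. -/
def holderQuot (s : ℝ) (u : EuclideanSpace ℝ (Fin n) → ℝ)
    (z : EuclideanSpace ℝ (Fin n) × EuclideanSpace ℝ (Fin n)) : ℝ :=
  (u z.1 - u z.2) / ‖z.1 - z.2‖ ^ s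

/-- `ℝ²ⁿ \ (Ωᶜ)²`. -/
def crossSet (Ω : Set (EuclideanSpace ℝ (Fin n))) :
    Set (EuclideanSpace ℝ (Fin n) × EuclideanSpace ℝ (Fin n)) :=
  (Ωᶜ ×ˢ Ωᶜ)ᶜ

/-- The modular `Φ_{G,Ω}(u) = ∫_Ω G(|u|) dx`, with values in `[0,∞]`. -/
def modular (g : ℝ → ℝ) (Ω : Set (EuclideanSpace ℝ (Fin n)))
    (u : EuclideanSpace ℝ (Fin n) → ℝ) : ENNReal :=
  ∫⁻ x in Ω, ENNReal.ofReal (youngFun g |u x|)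

/-- The modular `Φ_{G,β,Ωᶜ}(u) = ∫_{ℝⁿ\Ω} β G(|u|) dx`. -/
def modularExt (g : ℝ → ℝ) (β : EuclideanSpace ℝ (Fin n) → ℝ)
    (Ω : Set (EuclideanSpace ℝ (Fin n))) (u : EuclideanSpace ℝ (Fin n) → ℝ) : ENNReal :=
  ∫⁻ x in Ωᶜ, ENNReal.ofReal (β x * youngFun g |u x|)

/-- The fractional modular `∬_S G(|D_s u|) dx dy / |x - y|^n` over `S ⊆ ℝⁿ × ℝⁿ`; the cases
used are `S = ℝⁿ × ℝⁿ`, `S = Ω × Ω` and `S = ℝ²ⁿ \ (Ωᶜ)²`. -/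
def fracModular (g : ℝ → ℝ) (s : ℝ)
    (S : Set (EuclideanSpace ℝ (Fin n) × EuclideanSpace ℝ (Fin n)))
    (u : EuclideanSpace ℝ (Fin n) → ℝ) : ENNReal :=
  ∫⁻ z in S, ENNReal.ofReal (youngFun g |holderQuot s u z|) ∂(singMeasure n)

/-- `L^G(Ω)`, as a set of functions on `ℝⁿ` of which only the values on `Ω` matter. -/
def LG (g : ℝ → ℝ) (Ω : Set (EuclideanSpace ℝ (Fin n))) :
    Set (EuclideanSpace ℝ (Fin n) → ℝ) :=
  {u | AEMeasurable u (volume.restrict Ω) ∧ modular g Ω u < ⊤}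

/-- `W^{s,G}_reg(Ω)`; only the values of `u` on `Ω` matter. -/
def WReg (g : ℝ → ℝ) (s : ℝ) (Ω : Set (EuclideanSpace ℝ (Fin n))) :
    Set (EuclideanSpace ℝ (Fin n) → ℝ) :=
  {u | u ∈ LG g Ω ∧ fracModular g s (Ω ×ˢ Ω) u < ⊤}

/-- `W^{s,G}_0(Ω)`: functions in `W^{s,G}(ℝⁿ)` vanishing a.e. outside `Ω`. -/
def WZero (g : ℝ → ℝ) (s : ℝ) (Ω : Set (EuclideanSpace ℝ (Fin n))) :
    Set (EuclideanSpace ℝ (Fin n) → ℝ) :=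
  {u | u ∈ LG g univ ∧ fracModular g s univ u < ⊤ ∧ ∀ᵐ x ∂(volume.restrict Ωᶜ), u x = 0}

/-- `W^{s,G}_*(Ω)`: measurable functions on `ℝⁿ`, in `L^G(Ω)`, with finite modular over
`ℝ²ⁿ \ (Ωᶜ)²`. -/
def WStar (g : ℝ → ℝ) (s : ℝ) (Ω : Set (EuclideanSpace ℝ (Fin n))) :
    Set (EuclideanSpace ℝ (Fin n) → ℝ) :=
  {u | AEMeasurable u volume ∧ u ∈ LG g Ω ∧ fracModular g s (crossSet Ω) u < ⊤}

/-- The space `𝒳` of the Robin problem. -/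
def XSpace (g : ℝ → ℝ) (s : ℝ) (β : EuclideanSpace ℝ (Fin n) → ℝ)
    (Ω : Set (EuclideanSpace ℝ (Fin n))) : Set (EuclideanSpace ℝ (Fin n) → ℝ) :=
  {u | AEMeasurable u volume ∧
    fracModular g s (crossSet Ω) u + modular g Ω u + modularExt g β Ω u < ⊤}

/-- The form `∬_S g(|D_s u|) (D_s u / |D_s u|) D_s v dx dy / |x - y|^n`. -/
def fracForm (g : ℝ → ℝ) (s : ℝ)
    (S : Set (EuclideanSpace ℝ (Fin n) × EuclideanSpace ℝ (Fin n)))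
    (u v : EuclideanSpace ℝ (Fin n) → ℝ) : ℝ :=
  ∫ z in S, oddExt g (holderQuot s u z) * holderQuot s v z ∂(singMeasure n)

/-- `⟨(-Δ_g)^s u, v⟩`. -/
def pairing (g : ℝ → ℝ) (s : ℝ) (u v : EuclideanSpace ℝ (Fin n) → ℝ) : ℝ :=
  fracForm g s univ u v

/-- `⟨(-Δ_g)^s_Ω u, v⟩`, the pairing of the regional operator. -/
def pairingReg (g : ℝ → ℝ) (s : ℝ) (Ω : Set (EuclideanSpace ℝ (Fin n)))
    (u v : EuclideanSpace ℝ (Fin n) → ℝ) : ℝ :=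
  fracForm g s (Ω ×ˢ Ω) u v

/-- `⟨(-Δ_g)^s u, v⟩_*`. -/
def pairingStar (g : ℝ → ℝ) (s : ℝ) (Ω : Set (EuclideanSpace ℝ (Fin n)))
    (u v : EuclideanSpace ℝ (Fin n) → ℝ) : ℝ :=
  1 / 2 * fracForm g s (crossSet Ω) u v

/-- `lam` is an eigenvalue of the Dirichlet problem with eigenfunction `u`. (Non-triviality of `u`
is not part of this definition; it is enforced by a normalization `Φ_{G,Ω}(u) = μ > 0`. The same
applies to the three definitions below.) -/
def IsDirichletEigen (g : ℝ → ℝ) (s : ℝ) (Ω : Set (EuclideanSpace ℝ (Fin n)))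
    (lam : ℝ) (u : EuclideanSpace ℝ (Fin n) → ℝ) : Prop :=
  u ∈ WZero g s Ω ∧ ∀ v ∈ WZero g s Ω,
    pairing g s u v = (lam - 1) * ∫ x in Ω, oddExt g (u x) * v x

/-- `lam` is an eigenvalue of the Neumann problem with eigenfunction `u`. -/
def IsNeumannEigen (g : ℝ → ℝ) (s : ℝ) (Ω : Set (EuclideanSpace ℝ (Fin n)))
    (lam : ℝ) (u : EuclideanSpace ℝ (Fin n) → ℝ) : Prop :=
  u ∈ WStar g s Ω ∧ ∀ v ∈ WStar g s Ω,
    pairingStar g s Ω u v = (lam - 1) * ∫ x in Ω, oddExt g (u x) * v x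

/-- `lam` is an eigenvalue of the regional Neumann problem with eigenfunction `u`. -/
def IsRegionalNeumannEigen (g : ℝ → ℝ) (s : ℝ) (Ω : Set (EuclideanSpace ℝ (Fin n)))
    (lam : ℝ) (u : EuclideanSpace ℝ (Fin n) → ℝ) : Prop :=
  u ∈ WReg g s Ω ∧ ∀ v ∈ WReg g s Ω,
    pairingReg g s Ω u v = (lam - 1) * ∫ x in Ω, oddExt g (u x) * v x

/-- `lam` is an eigenvalue of the Robin problem with eigenfunction `u`. -/
def IsRobinEigen (g : ℝ → ℝ) (s : ℝ) (β : EuclideanSpace ℝ (Fin n) → ℝ)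
    (Ω : Set (EuclideanSpace ℝ (Fin n))) (lam : ℝ) (u : EuclideanSpace ℝ (Fin n) → ℝ) : Prop :=
  u ∈ XSpace g s β Ω ∧ ∀ v ∈ XSpace g s β Ω,
    pairingStar g s Ω u v =
      (lam - 1) * (∫ x in Ω, oddExt g (u x) * v x) - ∫ x in Ωᶜ, β x * oddExt g (u x) * v x

end FracOrlicz

end

/-!
Every pairing in the four problems is a monotone form: its integrand at `v = u` is
`g(|t|) |t| ≥ 0` with `t = D_s u` or `t = u`. Testing the equation against the eigenfunction itself
therefore gives `(λ - 1) b_u(u) ≥ 0`. The bound `t g(t) ≤ p⁺ G(t)` makes `b_u(u)` a convergent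
integral, positive because `u` does not vanish on `Ω`; hence `λ ≥ 1`, whatever the normalization.
-/

namespace FracOrlicz

section YoungDensity

variable {g : ℝ → ℝ} {p t : ℝ}

lemma IsYoungDensity.nonneg (hg : IsYoungDensity g) (ht : 0 ≤ t) : 0 ≤ g t := by
  rcases ht.eq_or_lt with rfl | ht
  · exact hg.zero.ge
  · exact (hg.pos t ht).le

lemma IsYoungDensity.monotoneOn_Ici (hg : IsYoungDensity g) : MonotoneOn g (Ici 0) := by
  intro a ha b hb hab
  rcases (mem_Ici.mp ha).eq_or_lt with rfl | ha
  · exact hg.zero.trans_le (hg.nonneg hb)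
  · exact hg.mono ha (ha.trans_le hab) hab

lemma IsYoungDensity.measurable_comp_abs (hg : IsYoungDensity g) :
    Measurable fun t : ℝ => g |t| := by
  have hmono : Monotone fun t : ℝ => g (max t 0) := fun _ _ hab =>
    hg.monotoneOn_Ici (mem_Ici.mpr (le_max_right _ _)) (mem_Ici.mpr (le_max_right _ _))
      (max_le_max_right 0 hab)
  simpa [Function.comp_def] using hmono.measurable.comp (measurable_norm (α := ℝ))

lemma youngFun_zero (g : ℝ → ℝ) : youngFun g 0 = 0 :=
  intervalIntegral.integral_same

lemma IsYoungDensity.youngFun_pos (hg : IsYoungDensity g) (ht : 0 < t) : 0 < youngFun g t := by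
  have hint : IntervalIntegrable g volume 0 t :=
    (hg.monotoneOn_Ici.mono (uIcc_of_le ht.le ▸ Icc_subset_Ici_self)).intervalIntegrable
  exact intervalIntegral.intervalIntegral_pos_of_pos_on hint (fun τ hτ => hg.pos τ hτ.1) ht

lemma IsYoungDensity.youngFun_nonneg (hg : IsYoungDensity g) (ht : 0 ≤ t) :
    0 ≤ youngFun g t :=
  intervalIntegral.integral_nonneg ht fun _ hτ => hg.nonneg hτ.1

lemma oddExt_mul_self (g : ℝ → ℝ) (t : ℝ) : oddExt g t * t = g |t| * |t| := by
  rw [oddExt, mul_assoc, div_mul_eq_mul_div, ← abs_mul_abs_self, mul_self_div_self]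

lemma IsYoungDensity.oddExt_mul_self_nonneg (hg : IsYoungDensity g) (t : ℝ) :
    0 ≤ oddExt g t * t := by
  rw [oddExt_mul_self]
  exact mul_nonneg (hg.nonneg (abs_nonneg t)) (abs_nonneg t)

lemma IsYoungDensity.oddExt_mul_self_eq_zero_iff (hg : IsYoungDensity g) :
    oddExt g t * t = 0 ↔ t = 0 := by
  refine ⟨fun h => ?_, fun h => by rw [h, mul_zero]⟩
  by_contra ht
  rw [oddExt_mul_self] at h
  exact (mul_pos (hg.pos _ (abs_pos.mpr ht)) (abs_pos.mpr ht)).ne' h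

lemma IsYoungDensity.oddExt_mul_self_le (hg : IsYoungDensity g)
    (hp : ∀ t : ℝ, 0 < t → t * g t / youngFun g t ≤ p) (t : ℝ) :
    oddExt g t * t ≤ p * youngFun g |t| := by
  rcases eq_or_ne t 0 with rfl | ht
  · simp only [mul_zero, abs_zero, youngFun_zero, le_refl]
  · have habs : 0 < |t| := abs_pos.mpr ht
    rw [oddExt_mul_self, mul_comm]
    exact (div_le_iff₀ (hg.youngFun_pos habs)).mp (hp _ habs)

end YoungDensity

section Integrals

variable {α : Type*} [MeasurableSpace α] {μ : Measure α} {g : ℝ → ℝ} {p : ℝ} {u : α → ℝ}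

lemma integrable_oddExt_mul_self (hg : IsYoungDensity g)
    (hp : ∀ t : ℝ, 0 < t → t * g t / youngFun g t ≤ p) (hu : AEMeasurable u μ)
    (hfin : ∫⁻ x, ENNReal.ofReal (youngFun g |u x|) ∂μ ≠ ⊤) :
    Integrable (fun x => oddExt g (u x) * u x) μ := by
  constructor
  · simp only [oddExt_mul_self]
    exact ((hg.measurable_comp_abs.mul measurable_norm).comp_aemeasurable hu).aestronglyMeasurable
  rw [hasFiniteIntegral_iff_ofReal (ae_of_all _ fun x => hg.oddExt_mul_self_nonneg (u x))]
  calc ∫⁻ x, ENNReal.ofReal (oddExt g (u x) * u x) ∂μ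
      ≤ ∫⁻ x, ENNReal.ofReal p * ENNReal.ofReal (youngFun g |u x|) ∂μ := by
        refine lintegral_mono fun x => ?_
        rw [← ENNReal.ofReal_mul' (hg.youngFun_nonneg (abs_nonneg _))]
        exact ENNReal.ofReal_le_ofReal (hg.oddExt_mul_self_le hp _)
    _ = ENNReal.ofReal p * ∫⁻ x, ENNReal.ofReal (youngFun g |u x|) ∂μ :=
        lintegral_const_mul' _ _ ENNReal.ofReal_ne_top
    _ < ⊤ := ENNReal.mul_lt_top ENNReal.ofReal_lt_top hfin.lt_top

lemma lintegral_youngFun_abs_eq_zero (g : ℝ → ℝ) (hu : u =ᵐ[μ] 0) :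
    ∫⁻ x, ENNReal.ofReal (youngFun g |u x|) ∂μ = 0 := by
  refine lintegral_eq_zero_of_ae_eq_zero (hu.mono fun x hx => ?_)
  simp only [hx, Pi.zero_apply, abs_zero, youngFun_zero, ENNReal.ofReal_zero]

lemma integral_oddExt_mul_self_pos (hg : IsYoungDensity g)
    (hp : ∀ t : ℝ, 0 < t → t * g t / youngFun g t ≤ p) (hu : AEMeasurable u μ)
    (hfin : ∫⁻ x, ENNReal.ofReal (youngFun g |u x|) ∂μ ≠ ⊤)
    (hne : ∫⁻ x, ENNReal.ofReal (youngFun g |u x|) ∂μ ≠ 0) :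
    0 < ∫ x, oddExt g (u x) * u x ∂μ := by
  have hnonneg : 0 ≤ fun x => oddExt g (u x) * u x := fun x => hg.oddExt_mul_self_nonneg (u x)
  refine (integral_nonneg hnonneg).lt_of_ne' fun hzero => hne ?_
  rw [integral_eq_zero_iff_of_nonneg hnonneg (integrable_oddExt_mul_self hg hp hu hfin)] at hzero
  exact lintegral_youngFun_abs_eq_zero g
    (hzero.mono fun _ hx => hg.oddExt_mul_self_eq_zero_iff.mp hx)

end Integrals

section Spaces

variable {n : ℕ} {g : ℝ → ℝ} {s : ℝ} {β u : EuclideanSpace ℝ (Fin n) → ℝ}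
  {Ω Ω' : Set (EuclideanSpace ℝ (Fin n))}

lemma LG_anti (h : Ω ⊆ Ω') : LG g Ω' ⊆ LG g Ω := fun _ hu =>
  ⟨hu.1.mono_measure (Measure.restrict_mono_set _ h), (lintegral_mono_set h).trans_lt hu.2⟩

lemma XSpace_subset_LG : XSpace g s β Ω ⊆ LG g Ω := fun _ hu =>
  ⟨hu.1.restrict, (le_add_self.trans le_self_add).trans_lt hu.2⟩

lemma fracForm_self_nonneg (hg : IsYoungDensity g) (s : ℝ)
    (S : Set (EuclideanSpace ℝ (Fin n) × EuclideanSpace ℝ (Fin n)))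
    (u : EuclideanSpace ℝ (Fin n) → ℝ) : 0 ≤ fracForm g s S u u :=
  integral_nonneg fun _ => hg.oddExt_mul_self_nonneg _

lemma pairingStar_self_nonneg (hg : IsYoungDensity g) (s : ℝ)
    (Ω : Set (EuclideanSpace ℝ (Fin n))) (u : EuclideanSpace ℝ (Fin n) → ℝ) :
    0 ≤ pairingStar g s Ω u u :=
  mul_nonneg one_half_pos.le (fracForm_self_nonneg hg s _ u)

lemma integral_weight_mul_oddExt_mul_self_nonneg (hg : IsYoungDensity g)
    (hβ : ∀ᵐ x ∂(volume.restrict Ω), 0 ≤ β x) (u : EuclideanSpace ℝ (Fin n) → ℝ) :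
    0 ≤ ∫ x in Ω, β x * oddExt g (u x) * u x := by
  refine integral_nonneg_of_ae (hβ.mono fun x hx => ?_)
  simp only [Pi.zero_apply, mul_assoc]
  exact mul_nonneg hx (hg.oddExt_mul_self_nonneg _)

end Spaces

section Eigenvalues

variable {n : ℕ} {g : ℝ → ℝ} {p s lam : ℝ} {β u : EuclideanSpace ℝ (Fin n) → ℝ}
  {Ω : Set (EuclideanSpace ℝ (Fin n))}

lemma one_le_of_nonneg_sub_one_mul_integral (hg : IsYoungDensity g)
    (hp : ∀ t : ℝ, 0 < t → t * g t / youngFun g t ≤ p) (hu : u ∈ LG g Ω)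
    (hne : modular g Ω u ≠ 0) (h : 0 ≤ (lam - 1) * ∫ x in Ω, oddExt g (u x) * u x) :
    1 ≤ lam :=
  sub_nonneg.mp <| nonneg_of_mul_nonneg_left h <|
    integral_oddExt_mul_self_pos hg hp hu.1 hu.2.ne hne

lemma IsDirichletEigen.one_le (hu : IsDirichletEigen g s Ω lam u) (hg : IsYoungDensity g)
    (hp : ∀ t : ℝ, 0 < t → t * g t / youngFun g t ≤ p) (hne : modular g Ω u ≠ 0) :
    1 ≤ lam := by
  refine one_le_of_nonneg_sub_one_mul_integral hg hp (LG_anti (subset_univ Ω) hu.1.1) hne ?_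
  exact (fracForm_self_nonneg hg s univ u).trans_eq (hu.2 u hu.1)

lemma IsNeumannEigen.one_le (hu : IsNeumannEigen g s Ω lam u) (hg : IsYoungDensity g)
    (hp : ∀ t : ℝ, 0 < t → t * g t / youngFun g t ≤ p) (hne : modular g Ω u ≠ 0) :
    1 ≤ lam := by
  refine one_le_of_nonneg_sub_one_mul_integral hg hp hu.1.2.1 hne ?_
  exact (pairingStar_self_nonneg hg s Ω u).trans_eq (hu.2 u hu.1)

lemma IsRegionalNeumannEigen.one_le (hu : IsRegionalNeumannEigen g s Ω lam u)
    (hg : IsYoungDensity g) (hp : ∀ t : ℝ, 0 < t → t * g t / youngFun g t ≤ p)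
    (hne : modular g Ω u ≠ 0) : 1 ≤ lam := by
  refine one_le_of_nonneg_sub_one_mul_integral hg hp hu.1.1 hne ?_
  exact (fracForm_self_nonneg hg s (Ω ×ˢ Ω) u).trans_eq (hu.2 u hu.1)

lemma IsRobinEigen.one_le (hu : IsRobinEigen g s β Ω lam u) (hg : IsYoungDensity g)
    (hp : ∀ t : ℝ, 0 < t → t * g t / youngFun g t ≤ p)
    (hβ : ∀ᵐ x ∂(volume.restrict Ωᶜ), 0 ≤ β x) (hne : modular g Ω u ≠ 0) : 1 ≤ lam := by
  refine one_le_of_nonneg_sub_one_mul_integral hg hp (XSpace_subset_LG hu.1) hne ?_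
  linarith [hu.2 u hu.1, pairingStar_self_nonneg hg s Ω u,
    integral_weight_mul_oddExt_mul_self_nonneg hg hβ u]

end Eigenvalues

end FracOrlicz

theorem mainTheorem8_general (n : ℕ) (s : ℝ) (g : ℝ → ℝ) (hg : FracOrlicz.IsYoungDensity g)
    (p : ℝ) (hp : ∀ t : ℝ, 0 < t → t * g t / FracOrlicz.youngFun g t ≤ p)
    (Ω : Set (EuclideanSpace ℝ (Fin n))) (β : EuclideanSpace ℝ (Fin n) → ℝ)
    (hβm : AEMeasurable β (volume.restrict Ωᶜ))
    (hβ : ∀ᵐ x ∂(volume.restrict Ωᶜ), 0 ≤ β x) (M : ENNReal) (hM : M ≠ 0) :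
    (∀ (lamD : ℝ) (u : EuclideanSpace ℝ (Fin n) → ℝ),
      FracOrlicz.IsDirichletEigen g s Ω lamD u →
      FracOrlicz.modular g Ω u = M → 1 ≤ lamD) ∧
    (∀ (lamR : ℝ) (u : EuclideanSpace ℝ (Fin n) → ℝ),
      FracOrlicz.IsRobinEigen g s β Ω lamR u →
      FracOrlicz.modular g Ω u = M → 1 ≤ lamR) ∧
    (∀ (lamN : ℝ) (u : EuclideanSpace ℝ (Fin n) → ℝ),
      FracOrlicz.IsNeumannEigen g s Ω lamN u →
      FracOrlicz.modular g Ω u = M → 1 ≤ lamN) ∧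
    (∀ (lamRegN : ℝ) (u : EuclideanSpace ℝ (Fin n) → ℝ),
      FracOrlicz.IsRegionalNeumannEigen g s Ω lamRegN u →
      FracOrlicz.modular g Ω u = M → 1 ≤ lamRegN) :=
  ⟨fun _ _ h hu => h.one_le hg hp (hu ▸ hM), fun _ _ h hu => h.one_le hg hp hβ (hu ▸ hM),
    fun _ _ h hu => h.one_le hg hp (hu ▸ hM), fun _ _ h hu => h.one_le hg hp (hu ▸ hM)⟩

theorem mainTheorem8 (n : ℕ) (hn : 1 ≤ n) (s : ℝ) (hs0 : 0 < s) (hs1 : s < 1)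
    (g : ℝ → ℝ) (hg : FracOrlicz.IsYoungDensity g)
    (pm pp : ℝ) (hG : FracOrlicz.GrowthCondition g pm pp)
    (Ω : Set (EuclideanSpace ℝ (Fin n))) (hΩo : IsOpen Ω) (hΩb : Bornology.IsBounded Ω)
    (β : EuclideanSpace ℝ (Fin n) → ℝ)
    (hβ : MemLp β ⊤ (volume.restrict Ωᶜ))
    (hβpos : ∀ᵐ x ∂(volume.restrict Ωᶜ), 0 < β x) :
    ∃ c : ℝ, 0 < c ∧ ∀ μ : ℝ, 0 < μ →
      (∀ (lamD : ℝ) (u : EuclideanSpace ℝ (Fin n) → ℝ),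
        FracOrlicz.IsDirichletEigen g s Ω lamD u →
        FracOrlicz.modular g Ω u = ENNReal.ofReal μ → c ≤ lamD) ∧
      (∀ (lamR : ℝ) (u : EuclideanSpace ℝ (Fin n) → ℝ),
        FracOrlicz.IsRobinEigen g s β Ω lamR u →
        FracOrlicz.modular g Ω u = ENNReal.ofReal μ → c ≤ lamR) ∧
      (∀ (lamN : ℝ) (u : EuclideanSpace ℝ (Fin n) → ℝ),
        FracOrlicz.IsNeumannEigen g s Ω lamN u →
        FracOrlicz.modular g Ω u = ENNReal.ofReal μ → c ≤ lamN) ∧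
      (∀ (lamRegN : ℝ) (u : EuclideanSpace ℝ (Fin n) → ℝ),
        FracOrlicz.IsRegionalNeumannEigen g s Ω lamRegN u →
        FracOrlicz.modular g Ω u = ENNReal.ofReal μ → c ≤ lamRegN) :=
  ⟨1, one_pos, fun _ hμ => mainTheorem8_general n s g hg pp (fun t ht => (hG.2 t ht).2) Ω β
    hβ.aemeasurable (hβpos.mono fun _ hx => hx.le) _ (ENNReal.ofReal_pos.mpr hμ).ne'⟩
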